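/- For $w,z\in\mathbb{C}$ with $\operatorname{Re}(w)>-1$ let $$\binom{w}{z}=\frac{\Gamma(w+1)}{\Gamma(z+1)\,\Gamma(w-z+1)},$$ where $1/\Gamma$ denotes the entire reciprocal Gamma function (so $1/\Gamma(s)=0$ for $s=0,-1,-2,\dots$). Let $w,\alpha\in\mathbb{C}$ with $\operatorname{Re}(w)>-1$ and $\operatorname{Re}(\alpha)>0$. Then the integral and the series below converge absolutely, and $$\int_{-\infty}^{\infty}\binom{w}{x}\frac{1}{x^2+\alpha^2}\,dx=\sum_{k=0}^{\infty}\binom{w}{k}\frac{1}{k^2+\alpha^2}-\frac{\pi}{\alpha\,(e^{2\pi\alpha}-1)}\left[\binom{w}{i\alpha}+\binom{w}{-i\alpha}\right].$$ -/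

import Mathlib

/-- The binomial coefficient with two complex arguments,
`Γ(w+1) / (Γ(z+1) Γ(w-z+1))`, for `w` not a negative integer. The reciprocal Gamma function is the
entire function `1/Γ`, which vanishes at `0, -1, -2, …`; this is what `(Complex.Gamma s)⁻¹` is in
Mathlib, since `Complex.Gamma` takes the value `0` at its poles. -/
noncomputable def complexBinom (w z : ℂ) : ℂ :=
  Complex.Gamma (w + 1) * (Complex.Gamma (z + 1))⁻¹ * (Complex.Gamma (w - z + 1))⁻¹

/-- For a natural number `k` the definition through the Gamma function agrees with
`w (w-1) ⋯ (w-k+1) / k!`. -/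
theorem complexBinom_natCast (w : ℂ) (hw : -1 < w.re) (k : ℕ) :
    complexBinom w (k : ℂ) = (∏ i ∈ Finset.range k, (w - (i : ℂ))) / (k.factorial : ℂ) := by
  have h0 : Complex.Gamma (w + 1) ≠ 0 := by
    apply Complex.Gamma_ne_zero_of_re_pos
    simp only [Complex.add_re, Complex.one_re]
    linarith
  have key : ∀ n : ℕ, Complex.Gamma (w + 1) * (Complex.Gamma (w - n + 1))⁻¹
      = ∏ i ∈ Finset.range n, (w - (i : ℂ)) := by
    intro n
    induction n with
    | zero => simp [h0]
    | succ n ih =>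
      have h := Complex.one_div_Gamma_eq_self_mul_one_div_Gamma_add_one (w - n)
      rw [Finset.prod_range_succ, ← ih]
      have e : w - ((n + 1 : ℕ) : ℂ) + 1 = w - n := by push_cast; ring
      rw [e, h]
      ring
  rw [← key k, complexBinom, Complex.Gamma_nat_eq_factorial]
  ring

/-! The function `y ↦ binom(w, y)` is band-limited: it is the Fourier transform of K(x) = (1 +
e^{2πix})^w cut to one period |x| ≤ 1/2 (`circleBinomIntegral_eq`, rescaled). Also (α/π)/(y² + α²)
is the Fourier transform of e^{-2πα|x|}. The multiplication formula turns α/π times the integral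
into ∫ K(x) e^{-2πα|x|} dx. Summing over integers instead replaces e^{-2πα|x|} by its periodization
(Poisson), which for |x| ≤ 1 exceeds it by (e^{2παx} + e^{-2παx})/(e^{2πα} - 1). Integrated against
K, these exponentials give `binom(w, ±iα)`: this is the correction term.

Cauchy's integral is first proved for Re w > 0 and Re z < 0, where a contour shift gives a Beta
integral and reflection gives the Gamma quotient. Recurrences shared by both sides extend it to all
z, then to Re w > -1. -/

/-! ### Size and integrability of (1 + e^{it})^w -/

/-- Points `1 + e^{it}` of the circle with centre and radius `1` avoid the branch cut. -/
theorem one_add_exp_mul_I_mem_slitPlane {t : ℝ} (ht : t ∈ Set.Ioo (-Real.pi) Real.pi) :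
    1 + Complex.exp (t * Complex.I) ∈ Complex.slitPlane := by
  left
  rw [Complex.add_re, Complex.exp_ofReal_mul_I_re, Complex.one_re]
  have h1 : Real.cos Real.pi < Real.cos |t| :=
    Real.cos_lt_cos_of_nonneg_of_le_pi (abs_nonneg t) le_rfl (abs_lt.2 ht)
  rw [Real.cos_abs, Real.cos_pi] at h1
  linarith

theorem norm_one_add_exp_mul_I (t : ℝ) :
    ‖1 + Complex.exp (t * Complex.I)‖ = 2 * |Real.cos (t / 2)| := by
  have h : 1 + Complex.exp (t * Complex.I) =
      (2 * Real.cos (t / 2) : ℝ) * Complex.exp ((t / 2 : ℝ) * Complex.I) := by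
    push_cast
    rw [Complex.two_cos, add_mul, ← Complex.exp_add, ← Complex.exp_add, add_comm]
    congr 1
    · congr 1; ring
    · rw [← Complex.exp_zero]; congr 1; ring
  rw [h, norm_mul, Complex.norm_exp_ofReal_mul_I, mul_one, Complex.norm_real, norm_mul]
  simp

theorem norm_cpow_le_rpow_mul_exp (v w : ℂ) (hv : v ≠ 0) :
    ‖v ^ w‖ ≤ ‖v‖ ^ w.re * Real.exp (Real.pi * |w.im|) := by
  rw [Complex.norm_cpow_of_ne_zero hv, div_eq_mul_inv, ← Real.exp_neg]
  gcongr
  calc -(v.arg * w.im) ≤ |v.arg * w.im| := neg_le_abs _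
    _ = |v.arg| * |w.im| := abs_mul _ _
    _ ≤ _ := by gcongr; exact Complex.abs_arg_le_pi v

theorem continuousOn_one_add_exp_cpow (w : ℂ) :
    ContinuousOn (fun t : ℝ => (1 + Complex.exp (t * Complex.I)) ^ w)
      (Set.Ioo (-Real.pi) Real.pi) := by
  intro t ht
  have h : ContinuousAt (fun t : ℝ => 1 + Complex.exp (t * Complex.I)) t := by fun_prop
  exact (h.cpow continuousAt_const (one_add_exp_mul_I_mem_slitPlane ht)).continuousWithinAt

/-- The base vanishes only at t = ±π, to first order, so Re w > -1 suffices; the argument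
contributes a bounded factor. -/
theorem intervalIntegrable_one_add_exp_cpow {w : ℂ} (hw : -1 < w.re) :
    IntervalIntegrable (fun t : ℝ => (1 + Complex.exp (t * Complex.I)) ^ w)
      MeasureTheory.volume (-Real.pi) Real.pi := by
  have hpi := Real.pi_pos
  obtain ⟨b, hb, hle⟩ : ∃ b : ℝ → ℝ,
      IntervalIntegrable b MeasureTheory.volume (-Real.pi) Real.pi ∧
      ∀ t ∈ Set.Ioo (-Real.pi) Real.pi, ‖1 + Complex.exp (t * Complex.I)‖ ^ w.re ≤ b t := by
    rcases le_or_gt 0 w.re with h | h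
    · refine ⟨fun _ => 2 ^ w.re, by simp, fun t _ => ?_⟩
      rw [norm_one_add_exp_mul_I]
      beta_reduce
      gcongr
      linarith [Real.abs_cos_le_one (t / 2)]
    · have h1 : IntervalIntegrable (fun t : ℝ => (Real.pi - t) ^ w.re) MeasureTheory.volume
          (-Real.pi) Real.pi := by
        have := (intervalIntegral.intervalIntegrable_rpow' hw
          (a := 2 * Real.pi) (b := 0)).comp_sub_left Real.pi
        simpa [two_mul] using this
      have h2 : IntervalIntegrable (fun t : ℝ => (Real.pi + t) ^ w.re) MeasureTheory.volume
          (-Real.pi) Real.pi := by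
        have := (intervalIntegral.intervalIntegrable_rpow' hw
          (a := 0) (b := 2 * Real.pi)).comp_add_left Real.pi
        simpa [two_mul] using this
      -- Since |t| is t or -t, the sum of the two endpoint powers dominates (π - |t|)^{Re w}; the
      -- factor 2/π comes from cos s ≥ 1 - 2s/π on [0, π/2].
      refine ⟨fun t => (2 / Real.pi) ^ w.re * ((Real.pi - t) ^ w.re + (Real.pi + t) ^ w.re),
        (h1.add h2).const_mul _, fun t ht => ?_⟩
      have habs : |t| < Real.pi := abs_lt.2 ht
      have hcos := Real.one_sub_mul_le_cos (x := |t| / 2) (by positivity) (by linarith)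
      have hlow : 2 / Real.pi * (Real.pi - |t|) ≤ ‖1 + Complex.exp (t * Complex.I)‖ := by
        rw [norm_one_add_exp_mul_I]
        have e : Real.cos (|t| / 2) = Real.cos (t / 2) := by
          rcases abs_cases t with ⟨h, _⟩ | ⟨h, _⟩
          · rw [h]
          · rw [h, neg_div, Real.cos_neg]
        rw [e] at hcos
        have e2 : 2 / Real.pi * (Real.pi - |t|) = 2 * (1 - 2 / Real.pi * (|t| / 2)) := by
          field_simp
        rw [e2]
        gcongr
        exact hcos.trans (le_abs_self _)
      have hpos : 0 < Real.pi - |t| := by linarith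
      calc ‖1 + Complex.exp (t * Complex.I)‖ ^ w.re
          ≤ (2 / Real.pi * (Real.pi - |t|)) ^ w.re :=
            Real.rpow_le_rpow_of_nonpos (by positivity) hlow h.le
        _ = (2 / Real.pi) ^ w.re * (Real.pi - |t|) ^ w.re :=
            Real.mul_rpow (by positivity) hpos.le
        _ ≤ _ := by
            have p1 : 0 ≤ (Real.pi - t) ^ w.re := Real.rpow_nonneg (by linarith [ht.2]) _
            have p2 : 0 ≤ (Real.pi + t) ^ w.re := Real.rpow_nonneg (by linarith [ht.1]) _
            beta_reduce
            gcongr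
            rcases abs_cases t with ⟨h, _⟩ | ⟨h, _⟩ <;> rw [h]
            · linarith
            · rw [sub_neg_eq_add]; linarith
  rw [intervalIntegrable_iff_integrableOn_Ioo_of_le (by linarith)] at hb ⊢
  refine (hb.mul_const (Real.exp (Real.pi * |w.im|))).mono'
    ((continuousOn_one_add_exp_cpow w).aestronglyMeasurable measurableSet_Ioo) ?_
  refine (MeasureTheory.ae_restrict_iff' measurableSet_Ioo).2 (Filter.Eventually.of_forall ?_)
  intro t ht
  have hne := Complex.slitPlane_ne_zero (one_add_exp_mul_I_mem_slitPlane ht)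
  refine (norm_cpow_le_rpow_mul_exp _ w hne).trans ?_
  gcongr
  exact hle t ht

/-! ### The circle integral and its recurrences -/

/-- The integral of `(1 + e^{it})^w e^{-izt}` over a period. -/
noncomputable def circleBinomIntegral (w z : ℂ) : ℂ :=
  ∫ t in (-Real.pi)..Real.pi, (1 + Complex.exp (t * Complex.I)) ^ w *
    Complex.exp (-(Complex.I * z * t))

theorem intervalIntegrable_circleBinom {w : ℂ} (hw : -1 < w.re) (z : ℂ) :
    IntervalIntegrable (fun t : ℝ => (1 + Complex.exp (t * Complex.I)) ^ w *
      Complex.exp (-(Complex.I * z * t))) MeasureTheory.volume (-Real.pi) Real.pi :=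
  (intervalIntegrable_one_add_exp_cpow hw).mul_continuousOn (by fun_prop)

theorem circleBinomIntegral_pascal {w : ℂ} (hw : -1 < w.re) (z : ℂ) :
    circleBinomIntegral (w + 1) z = circleBinomIntegral w z + circleBinomIntegral w (z - 1) := by
  unfold circleBinomIntegral
  rw [← intervalIntegral.integral_add (intervalIntegrable_circleBinom hw z)
    (intervalIntegrable_circleBinom hw (z - 1))]
  refine intervalIntegral.integral_congr_ae ?_
  -- At t = π the base is 0 and the exponent law for `cpow` is unavailable.
  have hne : ∀ᵐ t : ℝ, t ≠ Real.pi := by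
    simp [MeasureTheory.ae_iff]
  filter_upwards [hne] with t htne ht
  rw [Set.uIoc_of_le (by linarith [Real.pi_pos])] at ht
  have h0 := Complex.slitPlane_ne_zero
    (one_add_exp_mul_I_mem_slitPlane ⟨ht.1, lt_of_le_of_ne ht.2 htne⟩)
  have e : Complex.exp (-(Complex.I * (z - 1) * t)) =
      Complex.exp (t * Complex.I) * Complex.exp (-(Complex.I * z * t)) := by
    rw [← Complex.exp_add]; congr 1; ring
  rw [Complex.cpow_add _ _ h0, Complex.cpow_one, e]
  ring

/-- Integrate the derivative of (1 + e^{it})^{w+1} e^{-izt}: the boundary terms vanish because the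
base is 0 at ±π and Re(w + 1) > 0. -/
theorem circleBinomIntegral_absorb {w : ℂ} (hw : -1 < w.re) (z : ℂ) :
    (w + 1) * circleBinomIntegral w (z - 1) = z * circleBinomIntegral (w + 1) z := by
  have hw1 : 0 < (w + 1).re := by rw [Complex.add_re, Complex.one_re]; linarith
  have hle : -Real.pi ≤ Real.pi := by linarith [Real.pi_pos]
  have hcont : ContinuousOn (fun t : ℝ => (1 + Complex.exp (t * Complex.I)) ^ (w + 1) *
      Complex.exp (-(Complex.I * z * t))) (Set.Icc (-Real.pi) Real.pi) := by
    refine ContinuousOn.mul ?_ (by fun_prop)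
    intro t ht
    have h : ContinuousAt (fun t : ℝ => (1 + Complex.exp (t * Complex.I), w + 1)) t := by fun_prop
    refine (ContinuousAt.comp (g := fun p : ℂ × ℂ => p.1 ^ p.2)
      (Complex.continuousAt_cpow_of_re_pos (Or.inl ?_) hw1) h).continuousWithinAt
    simp only [Complex.add_re, Complex.exp_ofReal_mul_I_re, Complex.one_re]
    linarith [Real.neg_one_le_cos t]
  have hderiv : ∀ t ∈ Set.Ioo (-Real.pi) Real.pi,
      HasDerivAt (fun t : ℝ => (1 + Complex.exp (t * Complex.I)) ^ (w + 1) *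
        Complex.exp (-(Complex.I * z * t)))
        (Complex.I * ((w + 1) * ((1 + Complex.exp (t * Complex.I)) ^ w *
          Complex.exp (-(Complex.I * (z - 1) * t))) -
          z * ((1 + Complex.exp (t * Complex.I)) ^ (w + 1) *
          Complex.exp (-(Complex.I * z * t))))) t := by
    intro t ht
    have h1 : HasDerivAt (fun t : ℝ => 1 + Complex.exp (t * Complex.I))
        (Complex.exp (t * Complex.I) * (1 * Complex.I)) t :=
      ((Complex.ofRealCLM.hasDerivAt (x := t)).mul_const Complex.I).cexp.const_add 1
    have h2 : HasDerivAt (fun t : ℝ => Complex.exp (-(Complex.I * z * t)))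
        (Complex.exp (-(Complex.I * z * t)) * (-(Complex.I * z * 1))) t :=
      ((Complex.ofRealCLM.hasDerivAt (x := t)).const_mul (Complex.I * z)).neg.cexp
    have h3 := HasDerivAt.comp t ((hasDerivAt_id (1 + Complex.exp (t * Complex.I))).cpow_const
      (c := w + 1) (one_add_exp_mul_I_mem_slitPlane ht)) h1
    refine (h3.mul h2).congr_deriv ?_
    have e : Complex.exp (-(Complex.I * (z - 1) * t)) =
        Complex.exp (t * Complex.I) * Complex.exp (-(Complex.I * z * t)) := by
      rw [← Complex.exp_add]; congr 1; ring
    rw [e]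
    simp only [Function.comp, id, add_sub_cancel_right]
    ring
  have hi1 := (intervalIntegrable_circleBinom hw (z - 1)).const_mul (w + 1)
  have hi2 := (intervalIntegrable_circleBinom (show -1 < (w + 1).re by linarith) z).const_mul z
  have key := intervalIntegral.integral_eq_sub_of_hasDerivAt_of_le hle hcont hderiv
    ((hi1.sub hi2).const_mul Complex.I)
  have e0 : w + 1 ≠ 0 := fun h => by rw [h] at hw1; simp at hw1
  have em : 1 + Complex.exp (((-Real.pi : ℝ) : ℂ) * Complex.I) = 0 := by
    rw [Complex.ofReal_neg, neg_mul, Complex.exp_neg, Complex.exp_pi_mul_I]; norm_num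
  have ep : 1 + Complex.exp ((Real.pi : ℂ) * Complex.I) = 0 := by
    rw [Complex.exp_pi_mul_I]; norm_num
  rw [intervalIntegral.integral_const_mul, intervalIntegral.integral_sub hi1 hi2,
    intervalIntegral.integral_const_mul, intervalIntegral.integral_const_mul, em, ep,
    Complex.zero_cpow e0] at key
  have h := mul_left_cancel₀ Complex.I_ne_zero (key.trans (by simp : _ = Complex.I * 0))
  exact sub_eq_zero.1 h

theorem mul_circleBinomIntegral_add_one {w : ℂ} (hw : -1 < w.re) (z : ℂ) :
    (w + 1) * circleBinomIntegral w z = (w + 1 - z) * circleBinomIntegral (w + 1) z := by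
  linear_combination -(w + 1) * circleBinomIntegral_pascal hw z - circleBinomIntegral_absorb hw z

theorem mul_circleBinomIntegral_sub_one {w : ℂ} (hw : -1 < w.re) (z : ℂ) :
    z * circleBinomIntegral w z = (w + 1 - z) * circleBinomIntegral w (z - 1) := by
  linear_combination -z * circleBinomIntegral_pascal hw z - circleBinomIntegral_absorb hw z

/-! ### Contour shift to a Beta integral -/

/-- Integrating `(1 + e^u)^w e^{-zu}` around the rectangle `[-R, 0] × [-π, π]`. -/
theorem circleBinomIntegral_eq_rect {w z : ℂ} (hw : 0 < w.re) {R : ℝ} (hR : 0 ≤ R) :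
    Complex.I * circleBinomIntegral w z =
      Complex.I * (∫ y in (-Real.pi)..Real.pi,
        (1 + Complex.exp ((-R : ℝ) + y * Complex.I)) ^ w *
          Complex.exp (-(z * ((-R : ℝ) + y * Complex.I)))) +
      (Complex.exp (-(Complex.I * Real.pi * z)) - Complex.exp (Complex.I * Real.pi * z)) *
        ∫ y in Real.exp (-R)..1, (y : ℂ) ^ (-z - 1) * (1 - (y : ℂ)) ^ w := by
  set f : ℂ → ℂ := fun u => (1 + Complex.exp u) ^ w * Complex.exp (-(z * u)) with hf
  have hre : ∀ u : ℂ, -‖Complex.exp u‖ ≤ (Complex.exp u).re := fun u =>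
    neg_le_of_abs_le (Complex.abs_re_le_norm _)
  have hcont : ∀ u : ℂ, u.re ≤ 0 → ContinuousAt f u := by
    intro u hu
    refine ContinuousAt.mul ?_ (by fun_prop)
    have h : ContinuousAt (fun u : ℂ => (1 + Complex.exp u, w)) u := by fun_prop
    refine ContinuousAt.comp (g := fun p : ℂ × ℂ => p.1 ^ p.2)
      (Complex.continuousAt_cpow_of_re_pos (Or.inl ?_) hw) h
    have := hre u
    rw [Complex.norm_exp] at this
    have h1 := Real.exp_le_one_iff.2 hu
    simp only [Complex.add_re, Complex.one_re]
    linarith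
  have hdiff : ∀ u : ℂ, u.re < 0 → DifferentiableAt ℂ f u := by
    intro u hu
    refine DifferentiableAt.mul (DifferentiableAt.cpow (by fun_prop) (by fun_prop) (Or.inl ?_))
      (by fun_prop)
    have := hre u
    rw [Complex.norm_exp] at this
    have h1 := Real.exp_lt_exp.2 hu
    rw [Real.exp_zero] at h1
    simp only [Complex.add_re, Complex.one_re]
    linarith
  -- The corners ±iπ are zeros of 1 + e^u, so only continuity holds there; inside, |e^u| < 1 keeps 1
  -- + e^u off the cut.
  have key := Complex.integral_boundary_rect_eq_zero_of_continuousOn_of_differentiableOn f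
    ⟨-R, -Real.pi⟩ ⟨0, Real.pi⟩
    (fun u hu => (hcont u (by
      have := hu.1
      simp only [Set.uIcc_of_le (neg_nonpos.2 hR)] at this
      exact this.2)).continuousWithinAt)
    (fun u hu => (hdiff u (by
      have := hu.1
      simp only [max_eq_right (neg_nonpos.2 hR)] at this
      exact this.2)).differentiableWithinAt)
  -- On Im u = ±π one has e^u = -e^x, so both horizontal edges reduce to this integral; y = e^x
  -- makes it a truncated Beta integral.
  have hJ : ∫ x in (-R)..0, (1 - Complex.exp x) ^ w * Complex.exp (-(z * x)) =
      ∫ y in Real.exp (-R)..1, (y : ℂ) ^ (-z - 1) * (1 - (y : ℂ)) ^ w := by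
    have h := intervalIntegral.integral_deriv_smul_comp' (a := -R) (b := 0) (f := Real.exp)
      (f' := Real.exp) (g := fun y : ℝ => (y : ℂ) ^ (-z - 1) * (1 - (y : ℂ)) ^ w)
      (fun x _ => Real.hasDerivAt_exp x) Real.continuous_exp.continuousOn ?_
    · rw [Real.exp_zero] at h
      rw [← h]
      refine intervalIntegral.integral_congr fun x _ => ?_
      have hx : ((Real.exp x : ℝ) : ℂ) ^ (-z - 1) = Complex.exp (x * (-z - 1)) := by
        rw [Complex.cpow_def_of_ne_zero (by exact_mod_cast (Real.exp_pos x).ne'),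
          ← Complex.ofReal_log (Real.exp_pos x).le, Real.log_exp]
      simp only [Function.comp, Complex.real_smul]
      rw [hx, Complex.ofReal_exp, ← mul_assoc, ← Complex.exp_add, mul_comm]
      congr 2
      ring
    · rintro y ⟨x, hx, rfl⟩
      rw [Set.uIcc_of_le (neg_nonpos.2 hR)] at hx
      refine ContinuousAt.continuousWithinAt (ContinuousAt.mul ?_ ?_)
      · exact Complex.continuousAt_ofReal_cpow_const _ _ (Or.inr (Real.exp_pos x).ne')
      · have h : ContinuousAt (fun y : ℝ => (1 - (y : ℂ), w)) (Real.exp x) := by fun_prop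
        refine ContinuousAt.comp (g := fun p : ℂ × ℂ => p.1 ^ p.2)
          (Complex.continuousAt_cpow_of_re_pos (Or.inl ?_) hw) h
        have h1 := Real.exp_le_one_iff.2 hx.2
        simp only [Complex.sub_re, Complex.one_re, Complex.ofReal_re]
        linarith
  have hbot : ∫ x in (-R)..0, f (x + ((-Real.pi : ℝ) : ℂ) * Complex.I) =
      Complex.exp (Complex.I * Real.pi * z) *
        ∫ y in Real.exp (-R)..1, (y : ℂ) ^ (-z - 1) * (1 - (y : ℂ)) ^ w := by
    rw [← hJ, ← intervalIntegral.integral_const_mul]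
    refine intervalIntegral.integral_congr fun x _ => ?_
    have e1 : Complex.exp (x + ((-Real.pi : ℝ) : ℂ) * Complex.I) = -Complex.exp x := by
      rw [Complex.exp_add, Complex.ofReal_neg, neg_mul, Complex.exp_neg, Complex.exp_pi_mul_I]
      norm_num
    have e2 : Complex.exp (-(z * (x + ((-Real.pi : ℝ) : ℂ) * Complex.I))) =
        Complex.exp (Complex.I * Real.pi * z) * Complex.exp (-(z * x)) := by
      rw [← Complex.exp_add]; congr 1; push_cast; ring
    simp only [hf]
    rw [e1, e2, ← sub_eq_add_neg]
    ring
  have htop : ∫ x in (-R)..0, f (x + (Real.pi : ℂ) * Complex.I) =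
      Complex.exp (-(Complex.I * Real.pi * z)) *
        ∫ y in Real.exp (-R)..1, (y : ℂ) ^ (-z - 1) * (1 - (y : ℂ)) ^ w := by
    rw [← hJ, ← intervalIntegral.integral_const_mul]
    refine intervalIntegral.integral_congr fun x _ => ?_
    have e1 : Complex.exp (x + (Real.pi : ℂ) * Complex.I) = -Complex.exp x := by
      rw [Complex.exp_add, Complex.exp_pi_mul_I]
      norm_num
    have e2 : Complex.exp (-(z * (x + (Real.pi : ℂ) * Complex.I))) =
        Complex.exp (-(Complex.I * Real.pi * z)) * Complex.exp (-(z * x)) := by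
      rw [← Complex.exp_add]; congr 1; ring
    simp only [hf]
    rw [e1, e2, ← sub_eq_add_neg]
    ring
  have hright : ∫ y in (-Real.pi)..Real.pi, f (((0 : ℝ) : ℂ) + y * Complex.I) =
      circleBinomIntegral w z := by
    refine intervalIntegral.integral_congr fun y _ => ?_
    simp only [hf, Complex.ofReal_zero, zero_add]
    congr 2
    ring
  dsimp only at key
  rw [hbot, htop, hright] at key
  simp only [smul_eq_mul, hf] at key
  linear_combination key

/-- The power stays bounded since |1 + e^u| ≤ 2, while the exponential factor is O(e^{R Re z}). -/
theorem tendsto_integral_left_edge {w z : ℂ} (hw : 0 ≤ w.re) (hz : z.re < 0) :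
    Filter.Tendsto (fun R : ℝ => ∫ y in (-Real.pi)..Real.pi,
        (1 + Complex.exp ((-R : ℝ) + y * Complex.I)) ^ w *
          Complex.exp (-(z * ((-R : ℝ) + y * Complex.I)))) Filter.atTop (nhds 0) := by
  have hlim : Filter.Tendsto (fun R : ℝ => 2 ^ w.re * Real.exp (Real.pi * |w.im|) *
      (Real.exp (z.re * R) * Real.exp (Real.pi * |z.im|)) * |Real.pi - -Real.pi|)
      Filter.atTop (nhds 0) := by
    have h : Filter.Tendsto (fun R : ℝ => Real.exp (z.re * R)) Filter.atTop (nhds 0) :=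
      Real.tendsto_exp_atBot.comp (Filter.tendsto_id.const_mul_atTop_of_neg hz)
    simpa using ((h.mul_const (Real.exp (Real.pi * |z.im|))).const_mul
      (2 ^ w.re * Real.exp (Real.pi * |w.im|))).mul_const |Real.pi - -Real.pi|
  refine squeeze_zero_norm' ?_ hlim
  filter_upwards [Filter.eventually_gt_atTop 0] with R hR
  refine intervalIntegral.norm_integral_le_of_norm_le_const fun y hy => ?_
  rw [Set.uIoc_of_le (by linarith [Real.pi_pos])] at hy
  set v := Complex.exp ((-R : ℝ) + y * Complex.I) with hv
  have hvn : ‖v‖ < 1 := by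
    rw [hv, Complex.norm_exp]
    simpa using hR
  have hne : 1 + v ≠ 0 := by
    intro h
    rw [eq_neg_of_add_eq_zero_right h] at hvn
    simp at hvn
  rw [norm_mul]
  refine mul_le_mul ((norm_cpow_le_rpow_mul_exp _ w hne).trans ?_) ?_ (norm_nonneg _)
    (by positivity)
  · gcongr
    calc ‖1 + v‖ ≤ ‖(1 : ℂ)‖ + ‖v‖ := norm_add_le _ _
      _ ≤ 2 := by rw [norm_one]; linarith
  · rw [Complex.norm_exp, ← Real.exp_add]
    apply Real.exp_le_exp.2
    have h1 : z.im * y ≤ Real.pi * |z.im| := by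
      calc z.im * y ≤ |z.im * y| := le_abs_self _
        _ = |y| * |z.im| := by rw [abs_mul, mul_comm]
        _ ≤ _ := by gcongr; exact abs_le.2 ⟨hy.1.le, hy.2⟩
    simp
    linarith

theorem circleBinomIntegral_eq_beta {w z : ℂ} (hw : 0 < w.re) (hz : z.re < 0) :
    Complex.I * circleBinomIntegral w z =
      (Complex.exp (-(Complex.I * Real.pi * z)) - Complex.exp (Complex.I * Real.pi * z)) *
        Complex.betaIntegral (-z) (w + 1) := by
  have hconv := Complex.betaIntegral_convergent (u := -z) (v := w + 1)
    (by rw [Complex.neg_re]; linarith) (by rw [Complex.add_re, Complex.one_re]; linarith)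
  rw [add_sub_cancel_right] at hconv
  have hlim : Filter.Tendsto (fun R : ℝ => ∫ y in Real.exp (-R)..1,
      (y : ℂ) ^ (-z - 1) * (1 - (y : ℂ)) ^ w) Filter.atTop
      (nhds (Complex.betaIntegral (-z) (w + 1))) := by
    have hc := intervalIntegral.continuousOn_primitive_interval' hconv (a := 1) Set.right_mem_uIcc
    have h0 := (hc 0 Set.left_mem_uIcc).tendsto
    have he : Filter.Tendsto (fun R : ℝ => Real.exp (-R)) Filter.atTop
        (nhdsWithin 0 (Set.uIcc 0 1)) := by
      refine tendsto_nhdsWithin_iff.2 ⟨Real.tendsto_exp_neg_atTop_nhds_zero, ?_⟩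
      filter_upwards [Filter.eventually_ge_atTop 0] with R hR
      rw [Set.uIcc_of_le zero_le_one]
      exact ⟨(Real.exp_pos _).le, Real.exp_le_one_iff.2 (by linarith)⟩
    have h1 := (h0.comp he).neg
    refine (h1.congr fun R => ?_).trans (le_of_eq ?_)
    · rw [Function.comp, ← intervalIntegral.integral_symm]
    · rw [← intervalIntegral.integral_symm, Complex.betaIntegral, add_sub_cancel_right]
  have h := ((tendsto_integral_left_edge hw.le hz).const_mul Complex.I).add (hlim.const_mul
    (Complex.exp (-(Complex.I * Real.pi * z)) - Complex.exp (Complex.I * Real.pi * z)))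
  rw [mul_zero, zero_add] at h
  refine tendsto_nhds_unique (tendsto_const_nhds.congr' ?_) h
  filter_upwards [Filter.eventually_ge_atTop 0] with R hR
  exact circleBinomIntegral_eq_rect hw hR

theorem circleBinomIntegral_eq_of_re_neg {w z : ℂ} (hw : 0 < w.re) (hz : z.re < 0) :
    circleBinomIntegral w z = 2 * Real.pi * complexBinom w z := by
  have hz' : 0 < (-z).re := by rw [Complex.neg_re]; linarith
  have hrefl : -Complex.sin (Real.pi * z) * Complex.Gamma (-z) =
      Real.pi * (Complex.Gamma (z + 1))⁻¹ := by
    have h := Complex.Gamma_mul_Gamma_one_sub (-z)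
    rw [sub_neg_eq_add, add_comm 1 z, mul_neg, Complex.sin_neg] at h
    -- When the sine vanishes, the quotient in the reflection formula is 0 by convention; `Γ(-z) ≠
    -- 0` then forces `Γ(z + 1) = 0`, the intended value of 1/Γ.
    by_cases hs : Complex.sin (Real.pi * z) = 0
    · rw [hs, neg_zero, div_zero] at h
      have := (mul_eq_zero.1 h).resolve_left (Complex.Gamma_ne_zero_of_re_pos hz')
      rw [hs, this]
      simp
    · have hpi : (Real.pi : ℂ) ≠ 0 := by exact_mod_cast Real.pi_ne_zero
      have hne : Complex.Gamma (z + 1) ≠ 0 := by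
        intro h0
        rw [h0, mul_zero] at h
        exact div_ne_zero hpi (neg_ne_zero.2 hs) h.symm
      rw [eq_div_iff (neg_ne_zero.2 hs)] at h
      field_simp
      linear_combination h
  have hsin : Complex.exp (-(Complex.I * Real.pi * z)) - Complex.exp (Complex.I * Real.pi * z) =
      Complex.I * (2 * -Complex.sin (Real.pi * z)) := by
    have h := Complex.two_sin (Real.pi * z)
    have e1 : -(Real.pi * z) * Complex.I = -(Complex.I * Real.pi * z) := by ring
    have e2 : Real.pi * z * Complex.I = Complex.I * Real.pi * z := by ring
    rw [e1, e2] at h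
    linear_combination Complex.I * h + (Complex.exp (-(Complex.I * Real.pi * z)) -
      Complex.exp (Complex.I * Real.pi * z)) * Complex.I_sq
  have h := circleBinomIntegral_eq_beta hw hz
  rw [hsin, mul_assoc] at h
  rw [mul_left_cancel₀ Complex.I_ne_zero h, Complex.betaIntegral_eq_Gamma_mul_div _ _ hz'
    (by rw [Complex.add_re, Complex.one_re]; linarith), complexBinom,
    show -z + (w + 1) = w - z + 1 by ring, div_eq_mul_inv]
  linear_combination 2 * Complex.Gamma (w + 1) * (Complex.Gamma (w - z + 1))⁻¹ * hrefl

/-! ### Extension to all z and to Re w > -1 -/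

theorem mul_complexBinom_add_one {w : ℂ} (hw : w + 1 ≠ 0) (z : ℂ) :
    (w + 1) * complexBinom w z = (w + 1 - z) * complexBinom (w + 1) z := by
  have h := Complex.one_div_Gamma_eq_self_mul_one_div_Gamma_add_one (w - z + 1)
  have e : w + 1 - z + 1 = w - z + 1 + 1 := by ring
  rw [complexBinom, complexBinom, e, h, Complex.Gamma_add_one _ hw]
  ring

theorem mul_complexBinom_sub_one (w z : ℂ) :
    z * complexBinom w z = (w + 1 - z) * complexBinom w (z - 1) := by
  have h := Complex.one_div_Gamma_eq_self_mul_one_div_Gamma_add_one (w - z + 1)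
  have h' := Complex.one_div_Gamma_eq_self_mul_one_div_Gamma_add_one z
  have e : w - (z - 1) + 1 = w - z + 1 + 1 := by ring
  rw [complexBinom, complexBinom, e, sub_add_cancel, h, h']
  ring

theorem continuous_complexBinom (w : ℂ) : Continuous (complexBinom w) := by
  have h := Complex.differentiable_one_div_Gamma.continuous
  unfold complexBinom
  exact (continuous_const.mul (h.comp (continuous_id.add continuous_const))).mul
    (h.comp ((continuous_const.sub continuous_id).add continuous_const))

theorem continuous_circleBinomIntegral {w : ℂ} (hw : 0 < w.re) :
    Continuous (circleBinomIntegral w) := by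
  refine intervalIntegral.continuous_parametric_intervalIntegral_of_continuous' ?_ _ _
  refine Continuous.mul ?_ (by fun_prop)
  refine continuous_iff_continuousAt.2 fun p => ?_
  have h : ContinuousAt (fun p : ℂ × ℝ => (1 + Complex.exp (p.2 * Complex.I), w)) p := by fun_prop
  refine ContinuousAt.comp (g := fun p : ℂ × ℂ => p.1 ^ p.2)
    (Complex.continuousAt_cpow_of_re_pos (Or.inl ?_) hw) h
  simp only [Complex.add_re, Complex.exp_ofReal_mul_I_re, Complex.one_re]
  linarith [Real.neg_one_le_cos p.2]

theorem circleBinomIntegral_eq_of_re_pos {w : ℂ} (hw : 0 < w.re) (z : ℂ) :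
    circleBinomIntegral w z = 2 * Real.pi * complexBinom w z := by
  -- Each step moves Re z one unit right and divides by z. Excluding the naturals keeps every
  -- divisor nonzero; continuity restores them.
  have step : ∀ n : ℕ, ∀ z : ℂ, (∀ k : ℕ, z ≠ k) → z.re < n →
      circleBinomIntegral w z = 2 * Real.pi * complexBinom w z := by
    intro n
    induction n with
    | zero => exact fun z _ h => circleBinomIntegral_eq_of_re_neg hw (by simpa using h)
    | succ n ih =>
      intro z hz hlt
      have h0 : z ≠ 0 := by simpa using hz 0
      have h := ih (z - 1) (fun k hk => hz (k + 1) (by push_cast; rw [← hk]; ring))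
        (by rw [Complex.sub_re, Complex.one_re]; push_cast at hlt; linarith)
      apply mul_left_cancel₀ h0
      rw [mul_circleBinomIntegral_sub_one (by linarith), h]
      linear_combination (-(2 * Real.pi : ℂ)) * mul_complexBinom_sub_one w z
  have hdense : Dense (Set.range (fun k : ℕ => (k : ℂ)))ᶜ :=
    (Set.countable_range _).dense_compl ℝ
  refine congrFun (Continuous.ext_on hdense (continuous_circleBinomIntegral hw)
    (continuous_const.mul (continuous_complexBinom w)) ?_) z
  intro z hz
  obtain ⟨n, hn⟩ := exists_nat_gt z.re
  exact step n z (fun k hk => hz ⟨k, hk.symm⟩) hn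

/-- Cauchy's integral for the binomial coefficient:
`∫_{-π}^{π} (1 + e^{it})^w e^{-izt} dt = 2π binom(w, z)` for `Re w > -1`. -/
theorem circleBinomIntegral_eq {w : ℂ} (hw : -1 < w.re) (z : ℂ) :
    circleBinomIntegral w z = 2 * Real.pi * complexBinom w z := by
  have hw1 : 0 < (w + 1).re := by rw [Complex.add_re, Complex.one_re]; linarith
  have h0 : w + 1 ≠ 0 := fun h => by rw [h] at hw1; simp at hw1
  apply mul_left_cancel₀ h0
  rw [mul_circleBinomIntegral_add_one hw, circleBinomIntegral_eq_of_re_pos hw1]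
  linear_combination (-(2 * Real.pi : ℂ)) * mul_complexBinom_add_one h0 z

/-! ### The Lorentzian, its Fourier transform and Poisson summation -/

open scoped FourierTransform

theorem norm_one_div_sq_add_sq_le {α : ℂ} (hα : 0 < α.re) (y : ℝ) :
    ‖1 / ((y : ℂ) ^ 2 + α ^ 2)‖ ≤
      (α.re ^ 2 + α.im ^ 2 + 1) / α.re ^ 2 * (1 + y ^ 2)⁻¹ := by
  -- With a = Re α, right minus left is exactly ((y - b)b - a²)² + (y - b)². It is used for b = ± Im
  -- α, one for each factor y ± iα.
  have key : ∀ b : ℝ, (1 + y ^ 2) * α.re ^ 2 ≤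
      ((y - b) ^ 2 + α.re ^ 2) * (α.re ^ 2 + b ^ 2 + 1) := fun b => by
    nlinarith [sq_nonneg ((y - b) * b - α.re ^ 2), sq_nonneg (y - b)]
  have hfac : (y : ℂ) ^ 2 + α ^ 2 = (y + Complex.I * α) * (y - Complex.I * α) := by
    linear_combination (α ^ 2) * Complex.I_sq
  have h1 : ‖(y : ℂ) + Complex.I * α‖ ^ 2 = (y - α.im) ^ 2 + α.re ^ 2 := by
    rw [← Complex.normSq_eq_norm_sq, Complex.normSq_apply]; simp; ring
  have h2 : ‖(y : ℂ) - Complex.I * α‖ ^ 2 = (y - -α.im) ^ 2 + α.re ^ 2 := by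
    rw [← Complex.normSq_eq_norm_sq, Complex.normSq_apply]; simp; ring
  have k1 := key α.im
  have k2 := key (-α.im)
  rw [← h1] at k1
  rw [← h2, neg_sq] at k2
  have hM : 0 < α.re ^ 2 + α.im ^ 2 + 1 := by positivity
  have hle : (1 + y ^ 2) * α.re ^ 2 ≤
      ‖(y : ℂ) ^ 2 + α ^ 2‖ * (α.re ^ 2 + α.im ^ 2 + 1) := by
    refine (sq_le_sq₀ (by positivity) (by positivity)).1 ?_
    rw [hfac, norm_mul]
    calc ((1 + y ^ 2) * α.re ^ 2) ^ 2 = ((1 + y ^ 2) * α.re ^ 2) * ((1 + y ^ 2) * α.re ^ 2) := sq _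
      _ ≤ _ := mul_le_mul k1 k2 (by positivity) (by positivity)
      _ = _ := by ring
  have hpos : 0 < ‖(y : ℂ) ^ 2 + α ^ 2‖ := by
    refine pos_of_mul_pos_left (lt_of_lt_of_le ?_ hle) hM.le
    positivity
  rw [norm_div, norm_one, ← div_eq_mul_inv, div_div, div_le_div_iff₀ hpos (by positivity)]
  linarith

theorem sq_add_sq_ne_zero {α : ℂ} (hα : 0 < α.re) (y : ℝ) : (y : ℂ) ^ 2 + α ^ 2 ≠ 0 := by
  have hfac : (y : ℂ) ^ 2 + α ^ 2 = (y + Complex.I * α) * (y - Complex.I * α) := by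
    linear_combination (α ^ 2) * Complex.I_sq
  rw [hfac]
  refine mul_ne_zero (fun h => ?_) (fun h => ?_)
  · have := congrArg Complex.im h
    simp at this
    linarith
  · have := congrArg Complex.im h
    simp at this
    linarith

theorem continuous_one_div_sq_add_sq {α : ℂ} (hα : 0 < α.re) :
    Continuous (fun y : ℝ => 1 / ((y : ℂ) ^ 2 + α ^ 2)) :=
  continuous_const.div (by fun_prop) (sq_add_sq_ne_zero hα)

theorem integrable_one_div_sq_add_sq {α : ℂ} (hα : 0 < α.re) :
    MeasureTheory.Integrable (fun y : ℝ => 1 / ((y : ℂ) ^ 2 + α ^ 2)) :=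
  (integrable_inv_one_add_sq.const_mul _).mono'
    (continuous_one_div_sq_add_sq hα).aestronglyMeasurable
    (Filter.Eventually.of_forall (norm_one_div_sq_add_sq_le hα))

theorem summable_norm_one_div_sq_add_sq {α : ℂ} (hα : 0 < α.re) :
    Summable (fun n : ℤ => ‖1 / ((n : ℂ) ^ 2 + α ^ 2)‖) := by
  refine Summable.of_norm_bounded_eventually
    ((Real.summable_one_div_int_pow.2 one_lt_two).mul_left
      ((α.re ^ 2 + α.im ^ 2 + 1) / α.re ^ 2)) ?_
  filter_upwards [(Set.finite_singleton (0 : ℤ)).compl_mem_cofinite] with n hn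
  have hn' : (n : ℝ) ≠ 0 := by exact_mod_cast hn
  rw [norm_norm]
  refine (norm_one_div_sq_add_sq_le hα (n : ℝ)).trans' (le_of_eq (by simp)) |>.trans ?_
  rw [one_div]
  gcongr
  linarith

theorem continuous_exp_neg_mul_abs (c : ℂ) :
    Continuous (fun x : ℝ => Complex.exp (-(c * |x|))) := by
  fun_prop

theorem integrable_exp_neg_mul_abs {c : ℂ} (hc : 0 < c.re) :
    MeasureTheory.Integrable (fun x : ℝ => Complex.exp (-(c * |x|))) := by
  rw [← MeasureTheory.integrableOn_univ, ← Set.Iic_union_Ioi (a := (0 : ℝ))]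
  refine MeasureTheory.IntegrableOn.union ?_ ?_
  · refine (integrableOn_exp_mul_complex_Iic hc 0).congr_fun (fun x hx => ?_) measurableSet_Iic
    simp only [abs_of_nonpos (Set.mem_Iic.1 hx)]
    congr 1; push_cast; ring
  · refine (integrableOn_exp_mul_complex_Ioi (a := -c) (by simpa using hc) 0).congr_fun
      (fun x hx => ?_) measurableSet_Ioi
    simp only [abs_of_pos (Set.mem_Ioi.1 hx)]
    congr 1; ring

theorem fourier_exp_neg_mul_abs {α : ℂ} (hα : 0 < α.re) (y : ℝ) :
    𝓕 (fun x : ℝ => Complex.exp (-(2 * Real.pi * α * |x|))) y =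
      α / Real.pi * (1 / ((y : ℂ) ^ 2 + α ^ 2)) := by
  have hpi : (Real.pi : ℂ) ≠ 0 := by exact_mod_cast Real.pi_ne_zero
  have hre1 : 0 < (2 * Real.pi * (α - Complex.I * y)).re := by
    simp; positivity
  have hre2 : (-(2 * Real.pi * (α + Complex.I * y))).re < 0 := by
    simp; positivity
  have e1 : ∀ x ∈ Set.Iic (0 : ℝ), Complex.exp ((-2 * Real.pi * x * y : ℝ) * Complex.I) •
      Complex.exp (-(2 * Real.pi * α * |x|)) =
      Complex.exp (2 * Real.pi * (α - Complex.I * y) * x) := by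
    intro x hx
    rw [abs_of_nonpos (Set.mem_Iic.1 hx), smul_eq_mul, ← Complex.exp_add]
    congr 1; push_cast; ring
  have e2 : ∀ x ∈ Set.Ioi (0 : ℝ), Complex.exp ((-2 * Real.pi * x * y : ℝ) * Complex.I) •
      Complex.exp (-(2 * Real.pi * α * |x|)) =
      Complex.exp (-(2 * Real.pi * (α + Complex.I * y)) * x) := by
    intro x hx
    rw [abs_of_pos (Set.mem_Ioi.1 hx), smul_eq_mul, ← Complex.exp_add]
    congr 1; push_cast; ring
  have i1 := (integrableOn_exp_mul_complex_Iic hre1 0).congr_fun (fun x hx => (e1 x hx).symm)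
    measurableSet_Iic
  have i2 := (integrableOn_exp_mul_complex_Ioi hre2 0).congr_fun (fun x hx => (e2 x hx).symm)
    measurableSet_Ioi
  rw [Real.fourier_real_eq_integral_exp_smul, ← MeasureTheory.setIntegral_univ,
    ← Set.Iic_union_Ioi (a := (0 : ℝ)), MeasureTheory.setIntegral_union
      (Set.Iic_disjoint_Ioi le_rfl) measurableSet_Ioi i1 i2,
    MeasureTheory.setIntegral_congr_fun measurableSet_Iic e1,
    MeasureTheory.setIntegral_congr_fun measurableSet_Ioi e2,
    integral_exp_mul_complex_Iic hre1, integral_exp_mul_complex_Ioi hre2]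
  have n1 : α - Complex.I * y ≠ 0 := fun h => by rw [h] at hre1; simp at hre1
  have n2 : α + Complex.I * y ≠ 0 := fun h => by rw [h] at hre2; simp at hre2
  have n3 := sq_add_sq_ne_zero hα y
  have hfac : (y : ℂ) ^ 2 + α ^ 2 = (α + Complex.I * y) * (α - Complex.I * y) := by
    linear_combination ((y : ℂ) ^ 2) * Complex.I_sq
  rw [hfac]
  simp only [Complex.ofReal_zero, mul_zero, Complex.exp_zero]
  field_simp
  ring

/-- Fourier inversion at -x, with evenness removing the sign. -/
theorem fourier_fourier_exp_neg_mul_abs {α : ℂ} (hα : 0 < α.re) (x : ℝ) :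
    𝓕 (𝓕 (fun x : ℝ => Complex.exp (-(2 * Real.pi * α * |x|)))) x =
      Complex.exp (-(2 * Real.pi * α * |x|)) := by
  have hc : 0 < (2 * Real.pi * α).re := by simp; positivity
  have hF : MeasureTheory.Integrable
      (𝓕 (fun x : ℝ => Complex.exp (-(2 * Real.pi * α * |x|)))) := by
    rw [show 𝓕 (fun x : ℝ => Complex.exp (-(2 * Real.pi * α * |x|))) =
      fun y : ℝ => α / Real.pi * (1 / ((y : ℂ) ^ 2 + α ^ 2)) from
      funext (fourier_exp_neg_mul_abs hα)]
    exact (integrable_one_div_sq_add_sq hα).const_mul _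
  have h := congrFun ((continuous_exp_neg_mul_abs (2 * Real.pi * α)).fourierInv_fourier_eq
    (integrable_exp_neg_mul_abs hc) hF) (-x)
  rw [Real.fourierInv_eq_fourier_neg, neg_neg, abs_neg] at h
  exact h

/-- Poisson summation for `exp (-2πα|x|)`, in closed form on `[-1, 1]`. -/
theorem hasSum_fourier_one_div_sq_add_sq {α : ℂ} (hα : 0 < α.re) {x : ℝ} (hx : |x| ≤ 1) :
    HasSum (fun n : ℤ => α / Real.pi * (1 / ((n : ℂ) ^ 2 + α ^ 2)) *
        Complex.exp (-(2 * Real.pi * Complex.I * n * x)))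
      (Complex.exp (-(2 * Real.pi * α * |x|)) +
        (Complex.exp (2 * Real.pi * α * x) + Complex.exp (-(2 * Real.pi * α * x))) /
          (Complex.exp (2 * Real.pi * α) - 1)) := by
  set f : ℝ → ℂ := fun x : ℝ => Complex.exp (-(2 * Real.pi * α * |x|)) with hf
  have hc : 0 < (2 * Real.pi * α).re := by simp; positivity
  have hsum : Summable (fun n : ℤ => α / Real.pi * (1 / ((n : ℂ) ^ 2 + α ^ 2))) :=
    (summable_norm_one_div_sq_add_sq hα).of_norm.mul_left _
  have hF : ∀ n : ℤ, 𝓕 f n = α / Real.pi * (1 / ((n : ℂ) ^ 2 + α ^ 2)) := fun n => by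
    rw [hf, fourier_exp_neg_mul_abs hα]; simp
  have hdecay : f =O[Filter.cocompact ℝ] fun x : ℝ => |x| ^ (-2 : ℝ) := by
    have h := ((isLittleO_exp_neg_mul_rpow_atTop hc (-2)).isBigO.comp_tendsto
      (tendsto_norm_cocompact_atTop (E := ℝ)))
    refine (Asymptotics.IsBigO.of_norm_left ?_)
    refine h.congr_left fun x => ?_
    simp only [hf, Complex.norm_exp, Function.comp, Real.norm_eq_abs]
    congr 1
    simp
  have hP := Real.tsum_eq_tsum_fourier_of_rpow_decay_of_summable
    (continuous_exp_neg_mul_abs (2 * Real.pi * α)) one_lt_two hdecay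
    (hsum.congr fun n => (hF n).symm) (-x)
  have hterm : ∀ n : ℤ, 𝓕 f n * fourier n ((-x : ℝ) : UnitAddCircle) =
      α / Real.pi * (1 / ((n : ℂ) ^ 2 + α ^ 2)) *
        Complex.exp (-(2 * Real.pi * Complex.I * n * x)) := fun n => by
    rw [hF, fourier_coe_apply]
    congr 2
    push_cast
    ring
  have hs : Summable (fun n : ℤ => α / Real.pi * (1 / ((n : ℂ) ^ 2 + α ^ 2)) *
        Complex.exp (-(2 * Real.pi * Complex.I * n * x))) := by
    refine Summable.of_norm (hsum.norm.congr fun n => ?_)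
    rw [norm_mul _ (Complex.exp _), Complex.norm_exp]
    simp
  have hgeo : HasSum (fun n : ℤ => f (-x + n))
      (Complex.exp (-(2 * Real.pi * α * |x|)) +
        (Complex.exp (2 * Real.pi * α * x) + Complex.exp (-(2 * Real.pi * α * x))) /
          (Complex.exp (2 * Real.pi * α) - 1)) := by
    set q := Complex.exp (-(2 * Real.pi * α)) with hq
    have hqn : ‖q‖ < 1 := by
      rw [hq, Complex.norm_exp, Real.exp_lt_one_iff, Complex.neg_re]
      linarith
    have hqE : q * Complex.exp (2 * Real.pi * α) = 1 := by
      rw [hq, ← Complex.exp_add]; simp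
    have hq1 : 1 - q ≠ 0 := fun h => by
      rw [← sub_eq_zero.1 h] at hqn; simp at hqn
    have hE1 : Complex.exp (2 * Real.pi * α) - 1 ≠ 0 := fun h => by
      rw [sub_eq_zero.1 h, mul_one] at hqE
      rw [hqE] at hqn; simp at hqn
    have hqs : (q * (1 - q)⁻¹) = (Complex.exp (2 * Real.pi * α) - 1)⁻¹ := by
      field_simp
      linear_combination hqE
    have hg := (hasSum_geometric_of_norm_lt_one hqn).mul_left q
    rw [hqs] at hg
    have hpow : ∀ n : ℕ, q * q ^ n = Complex.exp (-(2 * Real.pi * α * (n + 1))) := fun n => by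
      rw [hq, ← Complex.exp_nat_mul, ← Complex.exp_add]
      congr 1; ring
    -- For |x| ≤ 1 the shifts -x ± (n + 1) have constant sign, so the absolute values open and each
    -- tail is geometric in q.
    have hx' := abs_le.1 hx
    have h1 : HasSum (fun n : ℕ => f (-x + ((n + 1 : ℤ) : ℝ)))
        (Complex.exp (2 * Real.pi * α * x) * (Complex.exp (2 * Real.pi * α) - 1)⁻¹) := by
      refine (hg.mul_left (Complex.exp (2 * Real.pi * α * x))).congr_fun fun n => ?_
      have hn : (0 : ℝ) ≤ n := n.cast_nonneg
      simp only [hf]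
      rw [hpow, abs_of_nonneg (by push_cast; linarith), ← Complex.exp_add]
      congr 1; push_cast; ring
    have h2 : HasSum (fun n : ℕ => f (-x + ((-(n + 1) : ℤ) : ℝ)))
        (Complex.exp (-(2 * Real.pi * α * x)) * (Complex.exp (2 * Real.pi * α) - 1)⁻¹) := by
      refine (hg.mul_left (Complex.exp (-(2 * Real.pi * α * x)))).congr_fun fun n => ?_
      have hn : (0 : ℝ) ≤ n := n.cast_nonneg
      simp only [hf]
      rw [hpow, abs_of_nonpos (by push_cast; linarith), ← Complex.exp_add]
      congr 1; push_cast; ring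
    convert HasSum.of_add_one_of_neg_add_one (f := fun n : ℤ => f (-x + n)) h1 h2 using 1
    simp only [hf, Int.cast_zero, add_zero, abs_neg]
    ring
  rw [← hgeo.tsum_eq]
  refine (hs.hasSum_iff).2 ?_
  rw [← tsum_congr hterm]
  exact hP.symm

/-! ### The binomial coefficient as a band-limited function -/

/-- The function on `(-1/2, 1/2]` whose Fourier transform is `binom(w, ·)`. -/
noncomputable def binomKernel (w : ℂ) (x : ℝ) : ℂ :=
  (1 + Complex.exp ((2 * Real.pi * x : ℝ) * Complex.I)) ^ w

theorem intervalIntegrable_binomKernel {w : ℂ} (hw : -1 < w.re) :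
    IntervalIntegrable (binomKernel w) MeasureTheory.volume (-(1 / 2)) (1 / 2) := by
  have hpi := Real.pi_pos
  have h := (intervalIntegrable_one_add_exp_cpow hw).comp_mul_left (c := 2 * Real.pi)
  have e1 : -Real.pi / (2 * Real.pi) = -(1 / 2) := by field_simp
  have e2 : Real.pi / (2 * Real.pi) = 1 / 2 := by field_simp
  rw [e1, e2] at h
  exact h

theorem integral_binomKernel_mul_exp {w : ℂ} (hw : -1 < w.re) (z : ℂ) :
    ∫ x in (-(1 / 2) : ℝ)..(1 / 2), binomKernel w x *
      Complex.exp (-(2 * Real.pi * Complex.I * z * x)) = complexBinom w z := by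
  have hpi : (2 * Real.pi : ℂ) ≠ 0 :=
    mul_ne_zero two_ne_zero (by exact_mod_cast Real.pi_ne_zero)
  have h := intervalIntegral.integral_comp_mul_left (a := -(1 / 2)) (b := 1 / 2)
    (fun t : ℝ => (1 + Complex.exp (t * Complex.I)) ^ w * Complex.exp (-(Complex.I * z * t)))
    (c := 2 * Real.pi) (by positivity)
  have e1 : 2 * Real.pi * -(1 / 2) = -Real.pi := by ring
  have e2 : 2 * Real.pi * (1 / 2) = Real.pi := by ring
  rw [e1, e2] at h
  have hc := circleBinomIntegral_eq hw z
  rw [circleBinomIntegral] at hc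
  rw [hc] at h
  calc _ = _ := ?_
    _ = _ := h
    _ = _ := ?_
  · refine intervalIntegral.integral_congr fun x _ => ?_
    simp only [binomKernel]
    congr 2
    push_cast
    ring
  · rw [Complex.real_smul, Complex.ofReal_inv, Complex.ofReal_mul, Complex.ofReal_ofNat,
      inv_mul_cancel_left₀ hpi]

theorem fourier_indicator_binomKernel {w : ℂ} (hw : -1 < w.re) (y : ℝ) :
    𝓕 ((Set.Ioc (-(1 / 2) : ℝ) (1 / 2)).indicator (binomKernel w)) y = complexBinom w y := by
  rw [← integral_binomKernel_mul_exp hw, intervalIntegral.integral_of_le (by norm_num),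
    Real.fourier_real_eq_integral_exp_smul,
    ← MeasureTheory.integral_indicator measurableSet_Ioc]
  refine MeasureTheory.integral_congr_ae (Filter.Eventually.of_forall fun x => ?_)
  simp only [Set.indicator_apply]
  split_ifs
  · rw [smul_eq_mul, mul_comm]
    congr 2
    push_cast
    ring
  · simp

/-- A Fourier transform is bounded by the L¹ norm. This reduces both absolute convergence claims to
those for 1/(y² + α²). -/
theorem exists_norm_complexBinom_le {w : ℂ} (hw : -1 < w.re) :
    ∃ C, ∀ y : ℝ, ‖complexBinom w y‖ ≤ C := by
  refine ⟨∫ x, ‖(Set.Ioc (-(1 / 2) : ℝ) (1 / 2)).indicator (binomKernel w) x‖, fun y => ?_⟩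
  rw [← fourier_indicator_binomKernel hw, Real.fourier_real_eq_integral_exp_smul]
  refine (MeasureTheory.norm_integral_le_integral_norm _).trans (le_of_eq ?_)
  refine MeasureTheory.integral_congr_ae (Filter.Eventually.of_forall fun x => ?_)
  simp only [norm_smul, Complex.norm_exp_ofReal_mul_I, one_mul]

theorem integrable_complexBinom_mul {w α : ℂ} (hw : -1 < w.re) (hα : 0 < α.re) :
    MeasureTheory.Integrable
      (fun x : ℝ => complexBinom w (x : ℂ) * (1 / ((x : ℂ) ^ 2 + α ^ 2))) := by
  obtain ⟨C, hC⟩ := exists_norm_complexBinom_le hw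
  exact (integrable_one_div_sq_add_sq hα).bdd_mul
    ((continuous_complexBinom w).comp Complex.continuous_ofReal).aestronglyMeasurable
    (Filter.Eventually.of_forall hC)

theorem summable_complexBinom_mul {w α : ℂ} (hw : -1 < w.re) (hα : 0 < α.re) :
    Summable (fun n : ℤ => complexBinom w (n : ℂ) * (1 / ((n : ℂ) ^ 2 + α ^ 2))) := by
  obtain ⟨C, hC⟩ := exists_norm_complexBinom_le hw
  refine Summable.of_norm_bounded ((summable_norm_one_div_sq_add_sq hα).mul_left C) fun n => ?_
  rw [norm_mul]
  gcongr
  simpa using hC n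

theorem complexBinom_negSucc (w : ℂ) (n : ℕ) : complexBinom w ((-(n + 1 : ℤ) : ℤ) : ℂ) = 0 := by
  have h : (((-(n + 1 : ℤ) : ℤ) : ℂ)) + 1 = -n := by push_cast; ring
  rw [complexBinom, h, Complex.Gamma_neg_nat_eq_zero]
  simp

/-! ### Integral and sum tested against the kernel -/

theorem integral_complexBinom_mul {w α : ℂ} (hw : -1 < w.re) (hα : 0 < α.re) :
    α / Real.pi * ∫ x : ℝ, complexBinom w (x : ℂ) * (1 / ((x : ℂ) ^ 2 + α ^ 2)) =
      ∫ x in (-(1 / 2) : ℝ)..(1 / 2), binomKernel w x *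
        Complex.exp (-(2 * Real.pi * α * |x|)) := by
  set f : ℝ → ℂ := fun x : ℝ => Complex.exp (-(2 * Real.pi * α * |x|)) with hf
  have hF : 𝓕 f = fun y : ℝ => α / Real.pi * (1 / ((y : ℂ) ^ 2 + α ^ 2)) :=
    funext (fourier_exp_neg_mul_abs hα)
  have hFi : MeasureTheory.Integrable (𝓕 f) := by
    rw [hF]
    exact (integrable_one_div_sq_add_sq hα).const_mul _
  have hφ : MeasureTheory.Integrable
      ((Set.Ioc (-(1 / 2) : ℝ) (1 / 2)).indicator (binomKernel w)) :=
    ((intervalIntegrable_iff_integrableOn_Ioc_of_le (by norm_num)).1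
      (intervalIntegrable_binomKernel hw)).integrable_indicator measurableSet_Ioc
  -- The multiplication formula ∫ φ̂ g = ∫ φ ĝ with g = `𝓕 f`, so that ĝ is f again.
  have h : ∫ y : ℝ, 𝓕 ((Set.Ioc (-(1 / 2) : ℝ) (1 / 2)).indicator (binomKernel w)) y • 𝓕 f y =
      ∫ x : ℝ, (Set.Ioc (-(1 / 2) : ℝ) (1 / 2)).indicator (binomKernel w) x • 𝓕 (𝓕 f) x := by
    simpa using! VectorFourier.integral_fourierIntegral_smul_eq_flip (L := innerₗ ℝ)
      Real.continuous_fourierChar continuous_inner hφ hFi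
  rw [← MeasureTheory.integral_const_mul, intervalIntegral.integral_of_le (by norm_num),
    ← MeasureTheory.integral_indicator measurableSet_Ioc]
  calc _ = _ := ?_
    _ = _ := h
    _ = _ := ?_
  · refine MeasureTheory.integral_congr_ae (Filter.Eventually.of_forall fun y => ?_)
    simp only [fourier_indicator_binomKernel hw, hF, smul_eq_mul]
    ring
  · refine MeasureTheory.integral_congr_ae (Filter.Eventually.of_forall fun x => ?_)
    simp only [hf, fourier_fourier_exp_neg_mul_abs hα, Set.indicator_apply, smul_eq_mul]
    split_ifs <;> simp

/-- Multiply the Poisson identity by the kernel and integrate termwise; absolute summability of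
1/(n² + α²) supplies the domination. -/
theorem hasSum_complexBinom_mul {w α : ℂ} (hw : -1 < w.re) (hα : 0 < α.re) :
    HasSum (fun n : ℤ => α / Real.pi * (complexBinom w (n : ℂ) * (1 / ((n : ℂ) ^ 2 + α ^ 2))))
      ((∫ x in (-(1 / 2) : ℝ)..(1 / 2), binomKernel w x *
        Complex.exp (-(2 * Real.pi * α * |x|))) +
      (complexBinom w (Complex.I * α) + complexBinom w (-(Complex.I * α))) /
        (Complex.exp (2 * Real.pi * α) - 1)) := by
  have hK := intervalIntegrable_binomKernel hw
  have hsum : Summable (fun n : ℤ => ‖α / Real.pi * (1 / ((n : ℂ) ^ 2 + α ^ 2))‖) :=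
    ((summable_norm_one_div_sq_add_sq hα).mul_left ‖α / Real.pi‖).congr fun n =>
      (norm_mul _ _).symm
  have h := intervalIntegral.hasSum_integral_of_dominated_convergence
    (μ := MeasureTheory.volume) (a := -(1 / 2)) (b := 1 / 2)
    (F := fun (n : ℤ) (x : ℝ) => binomKernel w x * (α / Real.pi * (1 / ((n : ℂ) ^ 2 + α ^ 2)) *
        Complex.exp (-(2 * Real.pi * Complex.I * n * x))))
    (fun (n : ℤ) x => ‖binomKernel w x‖ * ‖α / Real.pi * (1 / ((n : ℂ) ^ 2 + α ^ 2))‖)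
    (fun n => (hK.mul_continuousOn (by fun_prop)).aestronglyMeasurable_restrict_uIoc)
    (fun n => Filter.Eventually.of_forall fun x _ => le_of_eq (by
      rw [norm_mul, norm_mul _ (Complex.exp _), Complex.norm_exp]
      simp))
    (Filter.Eventually.of_forall fun x _ => hsum.mul_left _)
    (by simp_rw [tsum_mul_left]; exact hK.norm.mul_const _)
    (Filter.Eventually.of_forall fun x hx => (hasSum_fourier_one_div_sq_add_sq hα (by
      rw [Set.uIoc_of_le (by norm_num)] at hx
      exact abs_le.2 ⟨by linarith [hx.1], by linarith [hx.2]⟩)).mul_left _)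
  have hval : (∫ x in (-(1 / 2) : ℝ)..(1 / 2), binomKernel w x *
        Complex.exp (-(2 * Real.pi * α * |x|))) +
      (complexBinom w (Complex.I * α) + complexBinom w (-(Complex.I * α))) /
        (Complex.exp (2 * Real.pi * α) - 1) =
      ∫ x in (-(1 / 2) : ℝ)..(1 / 2), binomKernel w x * (Complex.exp (-(2 * Real.pi * α * |x|)) +
        (Complex.exp (2 * Real.pi * α * x) + Complex.exp (-(2 * Real.pi * α * x))) /
          (Complex.exp (2 * Real.pi * α) - 1)) := by
    rw [← integral_binomKernel_mul_exp hw, ← integral_binomKernel_mul_exp hw,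
      ← intervalIntegral.integral_add, ← intervalIntegral.integral_div,
      ← intervalIntegral.integral_add]
    · refine intervalIntegral.integral_congr fun x _ => ?_
      have e1 : -(2 * Real.pi * Complex.I * (Complex.I * α) * x) = 2 * Real.pi * α * x := by
        linear_combination (-(2 * Real.pi * α * x)) * Complex.I_sq
      have e2 : -(2 * Real.pi * Complex.I * -(Complex.I * α) * x) = -(2 * Real.pi * α * x) := by
        linear_combination (2 * Real.pi * α * x) * Complex.I_sq
      simp only [e1, e2]
      ring
    · exact hK.mul_continuousOn (by fun_prop)
    · exact ((hK.mul_continuousOn (by fun_prop)).add (hK.mul_continuousOn (by fun_prop))).div_const _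
    · exact hK.mul_continuousOn (by fun_prop)
    · exact hK.mul_continuousOn (by fun_prop)
  rw [hval]
  refine h.congr_fun fun n => ?_
  rw [← integral_binomKernel_mul_exp hw, ← intervalIntegral.integral_mul_const,
    ← intervalIntegral.integral_const_mul]
  refine intervalIntegral.integral_congr fun x _ => ?_
  ring

theorem mainTheorem10 (w α : ℂ) (hw : -1 < w.re) (hα : 0 < α.re) :
    MeasureTheory.Integrable
      (fun x : ℝ => complexBinom w (x : ℂ) * (1 / ((x : ℂ) ^ 2 + α ^ 2))) ∧
    Summable (fun k : ℕ => complexBinom w (k : ℂ) * (1 / ((k : ℂ) ^ 2 + α ^ 2))) ∧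
    ∫ x : ℝ, complexBinom w (x : ℂ) * (1 / ((x : ℂ) ^ 2 + α ^ 2)) =
      (∑' k : ℕ, complexBinom w (k : ℂ) * (1 / ((k : ℂ) ^ 2 + α ^ 2))) -
        (Real.pi : ℂ) / (α * (Complex.exp (2 * (Real.pi : ℂ) * α) - 1)) *
          (complexBinom w (Complex.I * α) + complexBinom w (-(Complex.I * α))) := by
  have hsZ := summable_complexBinom_mul hw hα
  have hsN : Summable (fun k : ℕ => complexBinom w (k : ℂ) * (1 / ((k : ℂ) ^ 2 + α ^ 2))) := by
    simpa [Function.comp_def] using hsZ.comp_injective Nat.cast_injective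
  refine ⟨integrable_complexBinom_mul hw hα, hsN, ?_⟩
  -- The two-sided sum is the one-sided one: 1/Γ(n + 1) vanishes at negative integers n.
  have hZN : HasSum (fun n : ℤ => complexBinom w (n : ℂ) * (1 / ((n : ℂ) ^ 2 + α ^ 2)))
      ((∑' k : ℕ, complexBinom w (k : ℂ) * (1 / ((k : ℂ) ^ 2 + α ^ 2))) + 0) := by
    refine HasSum.of_nat_of_neg_add_one ?_ ?_
    · simpa only [Int.cast_natCast] using hsN.hasSum
    · simp_rw [complexBinom_negSucc, zero_mul]
      exact hasSum_zero
  rw [add_zero] at hZN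
  have h := (hZN.mul_left (α / Real.pi)).unique (hasSum_complexBinom_mul hw hα)
  rw [← integral_complexBinom_mul hw hα] at h
  have hα0 : α ≠ 0 := fun h => by rw [h] at hα; simp at hα
  have hpi : (Real.pi : ℂ) ≠ 0 := by exact_mod_cast Real.pi_ne_zero
  have hE : Complex.exp (2 * Real.pi * α) - 1 ≠ 0 := by
    intro h0
    have h1 := congrArg norm (sub_eq_zero.1 h0)
    rw [Complex.norm_exp, norm_one, Real.exp_eq_one_iff] at h1
    have h2 : 0 < (2 * Real.pi * α).re := by simp; positivity
    exact h2.ne' h1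
  apply mul_left_cancel₀ (div_ne_zero hα0 hpi)
  rw [mul_sub, h]
  field_simp
  ring
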